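/- Let $z\ge 0$ be an integer and let $\mathbb{Z}[i_z]=\mathbb{Z}[X]/(X^2-zX+1)$, where $i_z$ is the class of $X$. For $\alpha=a+bi_z$ with $a,b\in\mathbb{Z}$ put $\overline{\alpha}=a+zb-bi_z$, so that $\alpha\overline{\alpha}=a^2+zab+b^2$. A prime $p\in\mathbb{Z}$ (possibly negative) is called \emph{regular} if it is irreducible in $\mathbb{Z}[i_z]$ and \emph{irregular} otherwise. An irregular prime $p$ is called \emph{special} if $p=\alpha\overline{\alpha}$ for some $\alpha\in\mathbb{Z}[i_z]$ such that $\alpha$ and $\overline{\alpha}$ are associated in $\mathbb{Z}[i_z]$. A solution of $x^2+zxy+y^2=M$ in integers is called \emph{primitive} if $x,y$ are coprime, and \emph{positive} if $x\ge 0$ and $y\ge 0$. Let $n\ge 0$, let $p_1,\dots,p_n$ be irregular, non-special primes with pairwise distinct absolute values, each of the form $p_l=\alpha_l\overline{\alpha_l}$ with $\alpha_l\in\mathbb{Z}[i_z]$, and let $k_1,\dots,k_n\ge 1$. Let each of $q_1,q_2\in\mathbb{Z}$ be either special or equal to $1$, with $|q_1|\neq|q_2|$ if both are special. Let $r_1,r_2\ge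 0$ be integers and suppose that $$M=q_1^{r_1}q_2^{r_2}\prod_{l=1}^n p_l^{k_l}>1 .$$ 1. If $r_1,r_2\in\{0,1\}$, then $x^2+zxy+y^2=M$ has exactly $\lceil 2^{n-1}\rceil$ positive, primitive solutions, where $(x,y)$ and $(y,x)$ are counted as the same solution. 2. If $q_j\neq 1$ and $r_j\ge 2$ for some $j\in\{1,2\}$, then $x^2+zxy+y^2=M$ has no primitive solution. Moreover: 3. If $\mathbb{Z}[i_z]$ is a unique factorization domain and $M>0$ is any integer divisible by a regular prime, then $x^2+zxy+y^2=M$ has no primitive solution. -/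

import Mathlib

/-- The `z`-ring `ℤ[i_z] = ℤ[X] / (X² - z X + 1)`: pairs `a + b i_z` with `i_z ^ 2 = -1 + z * i_z`.
Its norm is `QuadraticAlgebra.norm (a + b i_z) = a² + z a b + b²` and the conjugation
`a + b i_z ↦ (a + z b) - b i_z` is `star`. -/
abbrev ZRing (z : ℤ) : Type := QuadraticAlgebra ℤ (-1) z

namespace ZRing

theorem norm_eq (z : ℤ) (α : ZRing z) :
    QuadraticAlgebra.norm α = α.re ^ 2 + z * α.re * α.im + α.im ^ 2 := by
  rw [QuadraticAlgebra.norm_def]; ring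

theorem mul_mk (z a₁ a₂ b₁ b₂ : ℤ) :
    (⟨a₁, a₂⟩ * ⟨b₁, b₂⟩ : ZRing z) =
      ⟨a₁ * b₁ - a₂ * b₂, a₁ * b₂ + a₂ * b₁ + z * a₂ * b₂⟩ := by
  ext <;> simp <;> ring

theorem star_mk (z a₁ a₂ : ℤ) : star (⟨a₁, a₂⟩ : ZRing z) = ⟨a₁ + z * a₂, -a₂⟩ := rfl

/-- A (possibly negative) prime `p` of `ℤ` is regular if it is irreducible in `ℤ[i_z]`. -/
def IsRegularPrime (z p : ℤ) : Prop :=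
  Prime p ∧ Irreducible (p : ZRing z)

/-- A (possibly negative) prime `p` of `ℤ` is irregular if it is not irreducible in `ℤ[i_z]`. -/
def IsIrregularPrime (z p : ℤ) : Prop :=
  Prime p ∧ ¬ Irreducible (p : ZRing z)

/-- An irregular prime `p` is special if `p = α * conj α` for some `α` associated to `conj α`. -/
def IsSpecialPrime (z p : ℤ) : Prop :=
  IsIrregularPrime z p ∧ ∃ α : ZRing z, (p : ZRing z) = α * star α ∧ Associated α (star α)

end ZRing

/-- `(x, y)` is a primitive integer solution of `x² + z x y + y² = M`. -/
def IsPrimitiveSolution (z M x y : ℤ) : Prop :=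
  x ^ 2 + z * x * y + y ^ 2 = M ∧ IsCoprime x y

/-- The set of positive (i.e. with non-negative entries) primitive solutions of
`x² + z x y + y² = M`, where a solution is the unordered pair `{x, y}`. -/
def positivePrimitiveSolutions (z M : ℤ) : Set (Sym2 ℤ) :=
  {s | ∃ x y : ℤ, s = s(x, y) ∧ 0 ≤ x ∧ 0 ≤ y ∧ IsPrimitiveSolution z M x y}

/-!
Solutions of `x² + z x y + y² = M` are elements `γ = x + y i_z` of norm `M` in `ℤ[i_z]`, and
coprimality of `x` and `y` says that no prime integer divides `γ`. The ring need not be factorial,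
but an element whose norm is a prime integer `p` is a prime element, its residue ring being the
field with `|p|` elements (`prime_of_prime_norm`). So `M` is a product of prime elements, and the
divisors of `M`, among them every `γ` of norm `M`, factor uniquely.

If `p = α * star α` is not special, then `α` and `star α` are not associated, and a primitive `γ`
is divisible by only one of them, to the full power occurring in `M`
(`IsPrimitive.not_star_dvd`, `IsPrimitive.pow_dvd`). If `q = π * star π` is special, then `π ^ 2`
is associated to `q`, so `q ^ 2` cannot divide the norm of a primitive element
(`IsPrimitive.not_sq_dvd_norm`), while a single factor `q` forces the factor `π`. Hence primitive
elements of norm `M`, up to factors of norm one, correspond to choices of one prime from each pair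
`α l`, `star (α l)` (`eq_of_forall_dvd_iff`, `exists_forall_dvd_iff`). Each class has exactly one
member in the positive quadrant: existence is a descent (`exists_mul_nonneg`), and uniqueness holds
because no element of norm one has both coordinates positive (`eq_of_pos_of_eq_mul`). Exchanging
the coordinates is conjugation followed by multiplication by `i_z`, so it replaces a choice by the
opposite one, which leaves half of the `2 ^ n` choices.

The ring is a domain unless `z = 2`, and for `z = 2` norms are squares, so no prime is a norm.

When `ℤ[i_z]` is factorial, a regular prime is a prime element; dividing `M = γ * star γ` it divides
`γ` or its conjugate, hence `γ` itself.
-/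

namespace ZRing

variable {z : ℤ}

/-! ### Norm, conjugation and divisibility by integers -/

/-- An element `a + b i_z` is primitive if its coordinates `a`, `b` are coprime. -/
def IsPrimitive (γ : ZRing z) : Prop := IsCoprime γ.re γ.im

theorem intCast_dvd_iff {m : ℤ} {γ : ZRing z} :
    (m : ZRing z) ∣ γ ↔ m ∣ γ.re ∧ m ∣ γ.im :=
  QuadraticAlgebra.algebraMap_dvd_iff

theorem intCast_norm (γ : ZRing z) : ((γ.norm : ℤ) : ZRing z) = γ * star γ :=
  QuadraticAlgebra.algebraMap_norm_eq_mul_star γ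

theorem dvd_intCast_norm (γ : ZRing z) : γ ∣ ((γ.norm : ℤ) : ZRing z) :=
  intCast_norm γ ▸ dvd_mul_right _ _

theorem norm_eq_of_intCast_eq_mul_star {p : ℤ} {α : ZRing z} (h : (p : ZRing z) = α * star α) :
    α.norm = p := by
  rw [← intCast_norm] at h
  exact_mod_cast h.symm

theorem star_dvd_star {α β : ZRing z} (h : α ∣ β) : star α ∣ star β := by
  obtain ⟨c, rfl⟩ := h
  exact ⟨star c, star_mul' _ _⟩

theorem associated_star {α β : ZRing z} (h : Associated α β) : Associated (star α) (star β) := by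
  obtain ⟨u, rfl⟩ := h
  exact ⟨star u, by simp [star_mul']⟩

theorem isCoprime_of_isCoprime_norm {α β : ZRing z} (h : IsCoprime α.norm β.norm) :
    IsCoprime α β :=
  (h.map (Int.castRingHom (ZRing z))).of_isCoprime_of_dvd_left (dvd_intCast_norm α)
    |>.of_isCoprime_of_dvd_right (dvd_intCast_norm β)

/-! ### Zero divisors -/

/-- For `z = 2` the norm is the square `(a + b)²`. -/
theorem ne_two_of_prime_norm {α : ZRing z} (h : Prime α.norm) : z ≠ 2 := by
  rintro rfl
  refine (Prime.irreducible h).not_isSquare ⟨α.re + α.im, ?_⟩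
  rw [norm_eq]
  ring

theorem eq_zero_of_norm_eq_zero (hz : 0 ≤ z) (h2 : z ≠ 2) {γ : ZRing z} (h : γ.norm = 0) :
    γ = 0 := by
  obtain ⟨a, b⟩ := γ
  rw [norm_eq] at h
  simp only at h
  have hb : b = 0 := by
    by_contra hb
    -- completing the square exhibits the discriminant `z² - 4` as a square
    have hd : (2 * a + z * b) ^ 2 = b ^ 2 * (z ^ 2 - 4) := by linear_combination 4 * h
    obtain ⟨c, hc⟩ := (Int.pow_dvd_pow_iff two_ne_zero).1 (Dvd.intro _ hd.symm)
    have hc2 : c ^ 2 = z ^ 2 - 4 := by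
      refine mul_left_cancel₀ (pow_ne_zero 2 hb) ?_
      rw [← hd, hc]
      ring
    have hz2 : 2 ≤ z := by nlinarith [sq_nonneg c]
    have hz3 : 3 ≤ z := by omega
    have h1 : |c| < z := abs_lt_of_sq_lt_sq (by linarith) hz
    have h2 : z - 1 < |c| := lt_of_pow_lt_pow_left₀ 2 (abs_nonneg c) (by rw [sq_abs]; nlinarith)
    omega
  subst hb
  have ha : a = 0 := by simpa using h
  subst ha
  rfl

theorem isDomain (hz : 0 ≤ z) (h2 : z ≠ 2) : IsDomain (ZRing z) := by
  have : NoZeroDivisors (ZRing z) := ⟨fun {a b} hab => by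
    have h : a.norm * b.norm = 0 := by rw [← map_mul, hab, QuadraticAlgebra.norm_zero]
    exact (mul_eq_zero.1 h).imp (eq_zero_of_norm_eq_zero hz h2) (eq_zero_of_norm_eq_zero hz h2)⟩
  exact NoZeroDivisors.to_isDomain _

/-! ### Elements of prime norm -/

/-- For `α = a + b i_z` of prime norm `p`, divisibility by `α` is the vanishing modulo `p` of the
linear form `c + d i_z ↦ a d - b c`, the `i_z`-coordinate of `(star α) * (c + d i_z)`. -/
theorem dvd_iff_of_prime_norm {α β : ZRing z} (hα : Prime α.norm) :
    α ∣ β ↔ α.norm ∣ α.re * β.im - α.im * β.re := by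
  constructor
  · rintro ⟨c, rfl⟩
    refine ⟨c.im, ?_⟩
    rw [norm_eq]
    simp only [QuadraticAlgebra.re_mul, QuadraticAlgebra.im_mul]
    ring
  · intro h
    have hb : ¬ α.norm ∣ α.im := by
      intro hb
      have ha : α.norm ∣ α.re := by
        refine hα.dvd_of_dvd_pow (n := 2) ?_
        have : α.re ^ 2 = α.norm - α.im * (z * α.re + α.im) := by rw [norm_eq]; ring
        rw [this]
        exact dvd_sub dvd_rfl (hb.mul_right _)
      obtain ⟨x, hx⟩ := ha
      obtain ⟨y, hy⟩ := hb
      refine hα.not_isUnit (IsUnit.of_mul_eq_one (x ^ 2 + z * x * y + y ^ 2) ?_)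
      refine mul_left_cancel₀ hα.ne_zero ?_
      have := norm_eq z α
      rw [hx, hy] at this
      linear_combination -this
    have h1 : α.norm ∣ β.re * α.re + z * β.re * α.im + β.im * α.im := by
      refine (hα.dvd_or_dvd (a := α.im) ?_).resolve_left hb
      have : α.im * (β.re * α.re + z * β.re * α.im + β.im * α.im) =
          α.norm * β.im - (α.re + z * α.im) * (α.re * β.im - α.im * β.re) := by
        rw [norm_eq]; ring
      rw [this]
      exact dvd_sub (dvd_mul_right _ _) (h.mul_left _)
    obtain ⟨x, hx⟩ := h1
    obtain ⟨y, hy⟩ := h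
    -- `star α * β = p * (x + y i_z)`, and `p` is a nonzero integer
    refine ⟨⟨x, y⟩, ?_⟩
    have key : ((α.norm : ℤ) : ZRing z) * β = ((α.norm : ℤ) : ZRing z) * (α * ⟨x, y⟩) := by
      have e : star α * β = ((α.norm : ℤ) : ZRing z) * ⟨x, y⟩ := by
        ext
        · simp; linear_combination hx
        · simp; linear_combination hy
      calc _ = α * (star α * β) := by rw [intCast_norm, mul_assoc]
        _ = _ := by rw [e]; ring
    have hre := congrArg QuadraticAlgebra.re key
    have him := congrArg QuadraticAlgebra.im key
    ext
    · refine mul_left_cancel₀ hα.ne_zero ?_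
      simpa using hre
    · refine mul_left_cancel₀ hα.ne_zero ?_
      simpa using him

theorem prime_of_prime_norm {α : ZRing z} (hα : Prime α.norm) : Prime α := by
  refine ⟨?_, ?_, ?_⟩
  · rintro rfl
    exact hα.ne_zero (by simp)
  · intro h
    exact hα.not_isUnit (QuadraticAlgebra.isUnit_iff_norm_isUnit.1 h)
  · intro β γ h
    rw [dvd_iff_of_prime_norm hα] at h ⊢
    rw [dvd_iff_of_prime_norm hα]
    refine hα.dvd_or_dvd ?_
    -- the form `f` of `dvd_iff_of_prime_norm` satisfies `f β * f γ ≡ - b * f (β * γ)` modulo `p`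
    have : (α.re * β.im - α.im * β.re) * (α.re * γ.im - α.im * γ.re) =
        α.norm * (β.im * γ.im) - α.im * (α.re * (β * γ).im - α.im * (β * γ).re) := by
      rw [norm_eq]
      simp only [QuadraticAlgebra.re_mul, QuadraticAlgebra.im_mul]
      ring
    rw [this]
    exact dvd_sub (dvd_mul_right _ _) (h.mul_left _)

theorem prime_star_of_prime_norm {α : ZRing z} (hα : Prime α.norm) : Prime (star α) :=
  prime_of_prime_norm (by rwa [QuadraticAlgebra.norm_star])

/-! ### Primitive elements -/

theorem isPrimitive_iff {γ : ZRing z} :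
    IsPrimitive γ ↔ ∀ p : ℤ, Prime p → ¬ (p : ZRing z) ∣ γ := by
  constructor
  · intro h p hp hd
    rw [intCast_dvd_iff] at hd
    exact hp.not_isUnit (h.isUnit_of_dvd' hd.1 hd.2)
  · intro h
    have hne : ¬ (γ.re = 0 ∧ γ.im = 0) := fun h0 =>
      h 2 Int.prime_two (intCast_dvd_iff.2 (by simp [h0]))
    exact isCoprime_of_prime_dvd hne fun p hp h1 h2 => h p hp (intCast_dvd_iff.2 ⟨h1, h2⟩)

theorem IsPrimitive.of_dvd {γ δ : ZRing z} (h : IsPrimitive δ) (hd : γ ∣ δ) : IsPrimitive γ := by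
  rw [isPrimitive_iff] at *
  exact fun p hp hpd => h p hp (hpd.trans hd)

theorem isPrimitive_one : IsPrimitive (1 : ZRing z) := isCoprime_one_left

theorem IsPrimitive.mul {β γ : ZRing z} (hβ : IsPrimitive β) (hγ : IsPrimitive γ)
    (h : IsCoprime β.norm γ.norm) : IsPrimitive (β * γ) := by
  rw [isPrimitive_iff]
  intro p hp hd
  -- `p` divides `norm β * γ` and `norm γ * β`, but only one of the two norms
  have h1 : (p : ZRing z) ∣ ((β.norm : ℤ) : ZRing z) * γ := by
    rw [intCast_norm, mul_right_comm]; exact hd.mul_right _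
  have h2 : (p : ZRing z) ∣ ((γ.norm : ℤ) : ZRing z) * β := by
    rw [intCast_norm, mul_right_comm, mul_comm γ β]; exact hd.mul_right _
  rw [intCast_dvd_iff] at h1 h2
  simp only [QuadraticAlgebra.re_mul, QuadraticAlgebra.im_mul, QuadraticAlgebra.re_intCast,
    QuadraticAlgebra.im_intCast, mul_zero, zero_mul, add_zero, Int.cast_id] at h1 h2
  by_cases hn : p ∣ β.norm
  · have hn' : ¬ p ∣ γ.norm := fun hn' => hp.not_isUnit (h.isUnit_of_dvd' hn hn')
    exact isPrimitive_iff.1 hβ p hp (intCast_dvd_iff.2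
      ⟨(hp.dvd_or_dvd h2.1).resolve_left hn', (hp.dvd_or_dvd (by simpa using h2.2)).resolve_left hn'⟩)
  · exact isPrimitive_iff.1 hγ p hp (intCast_dvd_iff.2
      ⟨(hp.dvd_or_dvd h1.1).resolve_left hn, (hp.dvd_or_dvd (by simpa using h1.2)).resolve_left hn⟩)

theorem isPrimitive_of_prime_norm {α : ZRing z} (hα : Prime α.norm) : IsPrimitive α := by
  rw [isPrimitive_iff]
  rintro p hp ⟨β, hβ⟩
  have h : α.norm = p * (p * β.norm) := by
    rw [hβ, map_mul, QuadraticAlgebra.norm_intCast, Int.cast_id]; ring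
  exact hp.not_isUnit ((hα.irreducible.isUnit_or_isUnit h).elim id isUnit_of_mul_isUnit_left)

/-! ### Conjugate prime factors of a primitive element -/

theorem star_dvd_iff {α γ : ZRing z} : star α ∣ γ ↔ α ∣ star γ :=
  ⟨fun h => by simpa using star_dvd_star h, fun h => by simpa using star_dvd_star h⟩

theorem dvd_or_star_dvd {α γ : ZRing z} (hα : Prime α.norm) (h : α.norm ∣ γ.norm) :
    α ∣ γ ∨ star α ∣ γ := by
  rw [star_dvd_iff]
  refine (prime_of_prime_norm hα).dvd_or_dvd ?_
  rw [← intCast_norm]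
  exact (dvd_intCast_norm α).trans (Int.cast_dvd_cast _ _ h)

/-- If both conjugates divided `γ`, then so would the prime integer `α * star α`. -/
theorem IsPrimitive.not_star_dvd [IsDomain (ZRing z)] {α γ : ZRing z} (hγ : IsPrimitive γ)
    (hα : Prime α.norm) (hna : ¬ Associated α (star α)) (h : α ∣ γ) : ¬ star α ∣ γ := by
  rintro h'
  obtain ⟨c, rfl⟩ := h
  rcases (prime_star_of_prime_norm hα).dvd_or_dvd h' with h1 | h1
  · exact hna ((prime_star_of_prime_norm hα).associated_of_dvd (prime_of_prime_norm hα) h1).symm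
  · refine isPrimitive_iff.1 hγ _ hα ?_
    rw [intCast_norm]
    exact mul_dvd_mul_left _ h1

theorem IsPrimitive.pow_dvd [IsDomain (ZRing z)] {α γ : ZRing z} (hγ : IsPrimitive γ)
    (hα : Prime α.norm) (hna : ¬ Associated α (star α)) (h : α ∣ γ) {k : ℕ}
    (hk : α.norm ^ k ∣ γ.norm) : α ^ k ∣ γ := by
  have h1 : ¬ α ∣ star γ := fun h1 => hγ.not_star_dvd hα hna h (star_dvd_iff.2 h1)
  refine (prime_of_prime_norm hα).pow_dvd_of_dvd_mul_left k h1 ?_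
  rw [mul_comm, ← intCast_norm]
  refine dvd_trans ?_ (Int.cast_dvd_cast _ _ hk)
  rw [Int.cast_pow]
  exact pow_dvd_pow_of_dvd (dvd_intCast_norm α) k

theorem isPrimitive_pow [IsDomain (ZRing z)] {α : ZRing z}
    (hα : Prime α.norm) (hna : ¬ Associated α (star α)) (k : ℕ) : IsPrimitive (α ^ k) := by
  rw [isPrimitive_iff]
  intro p hp hd
  have h1 : p ∣ α.norm ^ k := by
    obtain ⟨β, hβ⟩ := hd
    have := congrArg QuadraticAlgebra.norm hβ
    rw [map_pow, map_mul, QuadraticAlgebra.norm_intCast] at this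
    rw [this, sq, mul_assoc]
    exact dvd_mul_right _ _
  have h2 : Associated p α.norm := hp.associated_of_dvd hα (hp.dvd_of_dvd_pow h1)
  have h3 : star α ∣ α ^ k := by
    refine dvd_trans ?_ ((Int.cast_dvd_cast _ _ h2.symm.dvd).trans hd)
    rw [intCast_norm]
    exact dvd_mul_left _ _
  have hs := prime_star_of_prime_norm hα
  exact hna (hs.associated_of_dvd (prime_of_prime_norm hα) (hs.dvd_of_dvd_pow h3)).symm

theorem dvd_of_associated_star {π γ : ZRing z} (hπ : Prime π.norm)
    (ha : Associated π (star π)) (h : π.norm ∣ γ.norm) : π ∣ γ :=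
  (dvd_or_star_dvd hπ h).elim id ha.dvd.trans

/-- If the square of a special prime divides the norm of `γ`, the prime element `π` above it divides
`γ` twice, and `π ^ 2` is the special prime up to a unit. -/
theorem IsPrimitive.not_sq_dvd_norm {π γ : ZRing z} (hγ : IsPrimitive γ) (hπ : Prime π.norm)
    (ha : Associated π (star π)) : ¬ π.norm ^ 2 ∣ γ.norm := by
  intro h
  obtain ⟨δ, rfl⟩ := dvd_of_associated_star hπ ha ((dvd_pow_self _ two_ne_zero).trans h)
  rw [map_mul, sq, mul_dvd_mul_iff_left hπ.ne_zero] at h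
  refine isPrimitive_iff.1 hγ _ hπ ?_
  rw [intCast_norm]
  exact mul_dvd_mul_left _ (ha.symm.dvd.trans (dvd_of_associated_star hπ ha h))

/-- The prime element above a special prime divides every element whose norm is divisible by the
special prime; the trivial factor `1` covers the cases `q = 1` and `r = 0`. -/
theorem exists_special_factor {q : ℤ} (hq : IsSpecialPrime z q ∨ q = 1) {r : ℕ} (hr : r ≤ 1) :
    ∃ g : ZRing z, g.norm = q ^ r ∧ IsPrimitive g ∧ ∀ γ : ZRing z, q ^ r ∣ γ.norm → g ∣ γ := by
  by_cases h : IsSpecialPrime z q ∧ r = 1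
  · obtain ⟨⟨⟨hp, -⟩, π, hπ, ha⟩, rfl⟩ := h
    have hn := norm_eq_of_intCast_eq_mul_star hπ
    subst hn
    refine ⟨π, by rw [pow_one], isPrimitive_of_prime_norm hp, fun γ hγ => ?_⟩
    rw [pow_one] at hγ
    exact dvd_of_associated_star hp ha hγ
  · have h1 : q ^ r = 1 := by
      rcases hq with hq | rfl
      · have : r = 0 := by
          have : r ≠ 1 := fun h1 => h ⟨hq, h1⟩
          omega
        rw [this, pow_zero]
      · exact one_pow r
    exact ⟨1, by rw [h1, map_one], isPrimitive_one, fun γ _ => one_dvd γ⟩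

theorem isCoprime_of_abs_ne {p q : ℤ} (hp : Prime p) (hq : Prime q) (h : |p| ≠ |q|) :
    IsCoprime p q := by
  refine hp.irreducible.coprime_iff_not_dvd.2 fun hd => h ?_
  rw [Int.abs_eq_natAbs, Int.abs_eq_natAbs,
    Int.associated_iff_natAbs.1 (hp.associated_of_dvd hq hd)]

/-- An irregular prime that is a norm and not special has a different absolute value from every
special prime, since the prime elements above `q` and above `-q` are the same. -/
theorem isCoprime_special [IsDomain (ZRing z)] {q : ℤ} {α : ZRing z}
    (hq : IsSpecialPrime z q ∨ q = 1) (hα : Prime α.norm) (hna : ¬ Associated α (star α)) :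
    IsCoprime q α.norm := by
  rcases hq with ⟨⟨hp, -⟩, π, hπ, ha⟩ | rfl
  · refine hp.irreducible.coprime_iff_not_dvd.2 fun hd => hna ?_
    have hn := norm_eq_of_intCast_eq_mul_star hπ
    subst hn
    have h1 : Associated π α :=
      (prime_of_prime_norm hp).associated_of_dvd (prime_of_prime_norm hα)
        (dvd_of_associated_star hp ha hd)
    exact h1.symm.trans (ha.trans (associated_star h1))
  · exact isCoprime_one_left

/-! ### Representatives in the positive quadrant -/

/-- Every orbit of elements of positive norm meets the closed positive quadrant. If the coordinates
have opposite signs, multiplication by `± i_z` or by its inverse either moves the point into the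
quadrant or decreases the sum of the absolute values of the coordinates. -/
theorem exists_mul_nonneg (γ : ZRing z) (h : 0 < γ.norm) :
    ∃ w : ZRing z, w.norm = 1 ∧ 0 ≤ (γ * w).re ∧ 0 ≤ (γ * w).im := by
  induction hm : γ.re.natAbs + γ.im.natAbs using Nat.strong_induction_on generalizing γ with
  | _ m ih =>
  subst hm
  have step : ∀ v : ZRing z, v.norm = 1 →
      (γ * v).re.natAbs + (γ * v).im.natAbs < γ.re.natAbs + γ.im.natAbs →
      ∃ w : ZRing z, w.norm = 1 ∧ 0 ≤ (γ * w).re ∧ 0 ≤ (γ * w).im := by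
    intro v hv hlt
    obtain ⟨w, hw, h1⟩ := ih _ hlt (γ * v) (by rw [map_mul, hv, mul_one]; exact h) rfl
    exact ⟨v * w, by rw [map_mul, hv, hw, one_mul], by rwa [← mul_assoc]⟩
  have n1 : QuadraticAlgebra.norm (⟨0, 1⟩ : ZRing z) = 1 := by rw [norm_eq]; simp
  have n2 : QuadraticAlgebra.norm (⟨z, -1⟩ : ZRing z) = 1 := by rw [norm_eq]; ring
  have n3 : QuadraticAlgebra.norm (⟨0, -1⟩ : ZRing z) = 1 := by rw [norm_eq]; simp
  have n4 : QuadraticAlgebra.norm (⟨-z, 1⟩ : ZRing z) = 1 := by rw [norm_eq]; ring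
  have n5 : QuadraticAlgebra.norm (-1 : ZRing z) = 1 := by simp
  have m1 : γ * ⟨0, 1⟩ = ⟨-γ.im, γ.re + z * γ.im⟩ := by
    ext <;> simp
  have m2 : γ * ⟨z, -1⟩ = ⟨z * γ.re + γ.im, -γ.re⟩ := by
    ext <;> simp <;> ring
  have m3 : γ * ⟨0, -1⟩ = ⟨γ.im, -(γ.re + z * γ.im)⟩ := by
    ext <;> simp; ring
  have m4 : γ * ⟨-z, 1⟩ = ⟨-(z * γ.re + γ.im), γ.re⟩ := by
    ext <;> simp <;> ring
  have s1 := step _ n1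
  have s2 := step _ n2
  rw [m1] at s1
  rw [m2] at s2
  simp only at s1 s2
  rw [norm_eq] at h
  -- with `a ≥ -b > 0`, positivity of the norm gives `a * (-(a + z * b)) < b ^ 2 ≤ a ^ 2`; the other
  -- cases are symmetric
  generalize hA : γ.re = a at *
  generalize hB : γ.im = b at *
  rcases le_or_gt 0 a with ha | ha <;> rcases le_or_gt 0 b with hb | hb
  · exact ⟨1, by simp, by simpa [hA], by simpa [hB]⟩
  · rcases le_or_gt (-b) a with hab | hab
    · rcases le_or_gt 0 (a + z * b) with hc | hc
      · exact ⟨_, n1, by rw [m1]; simpa using hb.le, by rw [m1]; exact hc⟩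
      · have : -(a + z * b) < a := by nlinarith
        exact s1 (by omega)
    · rcases le_or_gt (z * a + b) 0 with hc | hc
      · exact ⟨_, n4, by rw [m4]; simp only; omega, by rw [m4]; exact ha⟩
      · have : z * a + b < -b := by nlinarith
        exact s2 (by omega)
  · rcases le_or_gt b (-a) with hab | hab
    · rcases le_or_gt (a + z * b) 0 with hc | hc
      · exact ⟨_, n3, by rw [m3]; exact hb, by rw [m3]; simp only; omega⟩
      · have : a + z * b < -a := by nlinarith
        exact s1 (by omega)
    · rcases le_or_gt 0 (z * a + b) with hc | hc
      · exact ⟨_, n2, by rw [m2]; exact hc, by rw [m2]; simp only; omega⟩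
      · have : -(z * a + b) < b := by nlinarith
        exact s2 (by omega)
  · exact ⟨-1, n5, by simp [hA]; omega, by simp [hB]; omega⟩

theorem eq_one_of_norm_eq_one (hz : 0 ≤ z) {w : ZRing z} (hw : w.norm = 1) (h1 : 0 < w.re)
    (h2 : 0 < (star w).re) : w = 1 := by
  -- no element with both coordinates positive has norm one
  have aux : ∀ u v : ℤ, 0 < u → 0 < v → u ^ 2 + z * u * v + v ^ 2 ≠ 1 := by
    intro u v hu hv h
    have : 0 ≤ z * u * v := by positivity
    nlinarith
  have hs : (star w).norm = 1 := by rw [QuadraticAlgebra.norm_star, hw]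
  rw [norm_eq] at hw hs
  have hv : w.im = 0 := by
    rcases lt_trichotomy w.im 0 with h | h | h
    · exact absurd hs (aux _ _ h2 (by simpa using h))
    · exact h
    · exact absurd hw (aux _ _ h1 h)
  rw [hv] at hw
  ext
  · have : w.re ^ 2 = 1 := by simpa using hw
    simp only [QuadraticAlgebra.re_one]
    nlinarith
  · rw [hv, QuadraticAlgebra.im_one]

/-- The open positive quadrant contains at most one element of each orbit under multiplication by
elements of norm one. -/
theorem eq_of_pos_of_eq_mul (hz : 0 ≤ z) {γ δ w : ZRing z} (hw : w.norm = 1) (h : δ = γ * w)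
    (h1 : 0 < γ.re) (h2 : 0 < γ.im) (h3 : 0 < δ.re) (h4 : 0 < δ.im) : γ = δ := by
  have hn : 0 < γ.norm := by
    rw [norm_eq]; positivity
  suffices hw1 : w = 1 by rw [h, hw1, mul_one]
  apply eq_one_of_norm_eq_one hz hw
  · have e : star γ * δ = ((γ.norm : ℤ) : ZRing z) * w := by rw [h, intCast_norm]; ring
    have := congrArg QuadraticAlgebra.re e
    simp at this
    refine pos_of_mul_pos_right (a := γ.norm) ?_ hn.le
    rw [← this]
    have : 0 < γ.re * δ.re + z * γ.im * δ.re + γ.im * δ.im := by positivity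
    linarith
  · have e : γ * star δ = ((γ.norm : ℤ) : ZRing z) * star w := by
      rw [h, intCast_norm, star_mul']; ring
    have := congrArg QuadraticAlgebra.re e
    simp at this
    refine pos_of_mul_pos_right (a := γ.norm) ?_ hn.le
    rw [QuadraticAlgebra.re_star, ← this]
    have : 0 < γ.re * δ.re + z * γ.re * δ.im + γ.im * δ.im := by positivity
    linarith

/-! ### Choosing one prime from each conjugate pair -/

/-- The elements `a + b i_z` attached to the positive primitive solutions `(a, b)` of
`x² + z x y + y² = M`. -/
def positiveElements (z M : ℤ) : Set (ZRing z) :=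
  {γ | 0 ≤ γ.re ∧ 0 ≤ γ.im ∧ IsPrimitive γ ∧ γ.norm = M}

theorem pos_of_mem_positiveElements {M : ℤ} (hM : 1 < M) {γ : ZRing z}
    (h : γ ∈ positiveElements z M) : 0 < γ.re ∧ 0 < γ.im := by
  obtain ⟨h1, h2, h3, h4⟩ := h
  rw [norm_eq] at h4
  constructor
  · refine lt_of_le_of_ne h1 fun h0 => ?_
    rw [IsPrimitive, ← h0, isCoprime_zero_left, Int.isUnit_iff_abs_eq, abs_of_nonneg h2] at h3
    rw [← h0, h3] at h4
    norm_num at h4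
    omega
  · refine lt_of_le_of_ne h2 fun h0 => ?_
    rw [IsPrimitive, ← h0, isCoprime_zero_right, Int.isUnit_iff_abs_eq, abs_of_nonneg h1] at h3
    rw [← h0, h3] at h4
    norm_num at h4
    omega

open Classical in
/-- The product of `g` and the powers `σ l ^ k l`, where `σ l` is `α l` or its conjugate according
to `P l`. -/
noncomputable def choiceProd {ι : Type*} [Fintype ι] (g : ZRing z) (α : ι → ZRing z) (k : ι → ℕ)
    (P : ι → Prop) : ZRing z :=
  g * ∏ l, (if P l then α l else star (α l)) ^ k l

section choice

variable {ι : Type*} [Fintype ι] {g : ZRing z} {α : ι → ZRing z} {k : ι → ℕ}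

theorem norm_choiceProd (g : ZRing z) (α : ι → ZRing z) (k : ι → ℕ) (P : ι → Prop) :
    (choiceProd g α k P).norm = g.norm * ∏ l, (α l).norm ^ k l := by
  rw [choiceProd, map_mul, map_prod]
  congr 1
  refine Finset.prod_congr rfl fun l _ => ?_
  rw [map_pow]
  split_ifs
  · rfl
  · rw [QuadraticAlgebra.norm_star]

theorem isPrimitive_choiceProd [IsDomain (ZRing z)] (hα : ∀ l, Prime (α l).norm)
    (hna : ∀ l, ¬ Associated (α l) (star (α l)))
    (hco : Pairwise fun i j => IsCoprime (α i).norm (α j).norm)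
    (hg : IsPrimitive g) (hgα : ∀ l, IsCoprime g.norm (α l).norm) (P : ι → Prop) :
    IsPrimitive (choiceProd g α k P) := by
  classical
  have hσ : ∀ l, (if P l then α l else star (α l)).norm = (α l).norm := by
    intro l
    split_ifs
    · rfl
    · rw [QuadraticAlgebra.norm_star]
  have hprod : ∀ s : Finset ι,
      IsPrimitive (∏ l ∈ s, (if P l then α l else star (α l)) ^ k l) := by
    intro s
    induction s using Finset.induction_on with
    | empty => exact isPrimitive_one
    | insert i s hi ih =>
      rw [Finset.prod_insert hi]
      refine IsPrimitive.mul ?_ ih ?_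
      · split_ifs
        · exact isPrimitive_pow (hα i) (hna i) _
        · refine isPrimitive_pow (by rw [QuadraticAlgebra.norm_star]; exact hα i) ?_ _
          rw [star_star]
          exact fun h => hna i h.symm
      · rw [map_prod]
        refine IsCoprime.prod_right fun j hj => ?_
        rw [map_pow, map_pow, hσ, hσ]
        exact (hco (ne_of_mem_of_not_mem hj hi).symm).pow
  refine hg.mul (hprod _) ?_
  rw [map_prod]
  refine IsCoprime.prod_right fun j _ => ?_
  rw [map_pow, hσ]
  exact (hgα j).pow_right

/-- An element is, up to a factor of norm one, the product of the primes it is divisible by. -/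
theorem choiceProd_dvd [IsDomain (ZRing z)] (hα : ∀ l, Prime (α l).norm)
    (hna : ∀ l, ¬ Associated (α l) (star (α l)))
    (hco : Pairwise fun i j => IsCoprime (α i).norm (α j).norm)
    (hgα : ∀ l, IsCoprime g.norm (α l).norm) (hk : ∀ l, k l ≠ 0) {γ : ZRing z}
    (hγ : IsPrimitive γ) (hgγ : g ∣ γ) (hn : γ.norm = g.norm * ∏ l, (α l).norm ^ k l) :
    choiceProd g α k (fun l => α l ∣ γ) ∣ γ := by
  classical
  have hσ : ∀ l, (if α l ∣ γ then α l else star (α l)).norm = (α l).norm := by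
    intro l
    split_ifs
    · rfl
    · rw [QuadraticAlgebra.norm_star]
  have hd : ∀ l, (α l).norm ^ k l ∣ γ.norm := fun l =>
    hn ▸ (Finset.dvd_prod_of_mem (fun l => (α l).norm ^ k l) (Finset.mem_univ l)).mul_left _
  refine IsCoprime.mul_dvd ?_ hgγ (Finset.prod_dvd_of_coprime ?_ ?_)
  · refine IsCoprime.prod_right fun l _ => IsCoprime.pow_right ?_
    exact isCoprime_of_isCoprime_norm (by rw [hσ]; exact hgα l)
  · intro i _ j _ hij
    exact (isCoprime_of_isCoprime_norm (by rw [hσ, hσ]; exact hco hij)).pow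
  · intro l _
    split_ifs with h
    · exact hγ.pow_dvd (hα l) (hna l) h (hd l)
    · have h' : star (α l) ∣ γ :=
        (dvd_or_star_dvd (hα l) ((dvd_pow_self _ (hk l)).trans (hd l))).resolve_left h
      refine hγ.pow_dvd ?_ ?_ h' ?_
      · rw [QuadraticAlgebra.norm_star]; exact hα l
      · rw [star_star]; exact fun h => hna l h.symm
      · rw [QuadraticAlgebra.norm_star]; exact hd l

/-- A positive primitive element of norm `M` is determined by the `α l` it is divisible by. -/
theorem eq_of_forall_dvd_iff [IsDomain (ZRing z)] (hz : 0 ≤ z) (hα : ∀ l, Prime (α l).norm)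
    (hna : ∀ l, ¬ Associated (α l) (star (α l)))
    (hco : Pairwise fun i j => IsCoprime (α i).norm (α j).norm)
    (hgα : ∀ l, IsCoprime g.norm (α l).norm) (hk : ∀ l, k l ≠ 0)
    (hgd : ∀ γ : ZRing z, g.norm ∣ γ.norm → g ∣ γ)
    {M : ℤ} (hM : M = g.norm * ∏ l, (α l).norm ^ k l) (hM1 : 1 < M) {γ δ : ZRing z}
    (hγ : γ ∈ positiveElements z M) (hδ : δ ∈ positiveElements z M)
    (h : ∀ l, α l ∣ γ ↔ α l ∣ δ) : γ = δ := by
  have hdvd : ∀ ε ∈ positiveElements z M,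
      ∃ u : ZRing z, u.norm = 1 ∧ ε = choiceProd g α k (fun l => α l ∣ ε) * u := by
    rintro ε ⟨-, -, hp, hn⟩
    have hgε : g ∣ ε := hgd ε (by rw [hn, hM]; exact dvd_mul_right _ _)
    obtain ⟨u, hu⟩ := choiceProd_dvd hα hna hco hgα hk hp hgε (hn.trans hM)
    refine ⟨u, ?_, hu⟩
    have := congrArg QuadraticAlgebra.norm hu
    rw [map_mul, norm_choiceProd, ← hM, hn] at this
    exact mul_left_cancel₀ (by omega) (this.symm.trans (mul_one M).symm)
  obtain ⟨u, hu, hγu⟩ := hdvd γ hγ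
  obtain ⟨v, hv, hδv⟩ := hdvd δ hδ
  have hp1 := pos_of_mem_positiveElements hM1 hγ
  have hp2 := pos_of_mem_positiveElements hM1 hδ
  refine eq_of_pos_of_eq_mul hz (w := star u * v) ?_ ?_ hp1.1 hp1.2 hp2.1 hp2.2
  · rw [map_mul, QuadraticAlgebra.norm_star, hu, hv, one_mul]
  · have huu : u * star u = 1 := by rw [← intCast_norm, hu, Int.cast_one]
    have hP : (fun l => α l ∣ γ) = fun l => α l ∣ δ := funext fun l => propext (h l)
    rw [hP] at hγu
    calc δ = choiceProd g α k (fun l => α l ∣ δ) * v := hδv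
      _ = choiceProd g α k (fun l => α l ∣ δ) * (u * star u) * v := by rw [huu, mul_one]
      _ = γ * (star u * v) := by rw [hγu]; ring

/-- Every choice of one prime from each conjugate pair comes from a positive primitive element. -/
theorem exists_forall_dvd_iff [IsDomain (ZRing z)] (hα : ∀ l, Prime (α l).norm)
    (hna : ∀ l, ¬ Associated (α l) (star (α l)))
    (hco : Pairwise fun i j => IsCoprime (α i).norm (α j).norm)
    (hg : IsPrimitive g) (hgα : ∀ l, IsCoprime g.norm (α l).norm) (hk : ∀ l, k l ≠ 0)
    {M : ℤ} (hM : M = g.norm * ∏ l, (α l).norm ^ k l) (hM1 : 1 < M) (P : ι → Prop) :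
    ∃ γ ∈ positiveElements z M, ∀ l, α l ∣ γ ↔ P l := by
  classical
  have hnorm : (choiceProd g α k P).norm = M := (norm_choiceProd g α k P).trans hM.symm
  obtain ⟨w, hw, h1, h2⟩ := exists_mul_nonneg (choiceProd g α k P) (by omega)
  have hww : choiceProd g α k P = choiceProd g α k P * w * star w := by
    rw [mul_assoc, ← intCast_norm, hw, Int.cast_one, mul_one]
  have hp : IsPrimitive (choiceProd g α k P * w) :=
    (isPrimitive_choiceProd hα hna hco hg hgα P).of_dvd ⟨star w, hww⟩
  refine ⟨_, ⟨h1, h2, hp, by rw [map_mul, hw, hnorm, mul_one]⟩, fun l => ?_⟩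
  have hl : (if P l then α l else star (α l)) ∣ choiceProd g α k P * w :=
    ((dvd_pow_self _ (hk l)).trans ((Finset.dvd_prod_of_mem
      (fun l => (if P l then α l else star (α l)) ^ k l)
      (Finset.mem_univ l)).mul_left g)).mul_right w
  constructor
  · intro h
    by_contra hP
    rw [if_neg hP] at hl
    exact hp.not_star_dvd (hα l) (hna l) h hl
  · intro hP
    rwa [if_pos hP] at hl

end choice

/-! ### Unordered solutions -/

/-- Exchanging the two coordinates of `γ` is the map `γ ↦ i_z * star γ`. -/
theorem dvd_swap_iff {α γ : ZRing z} : α ∣ ⟨γ.im, γ.re⟩ ↔ star α ∣ γ := by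
  have h1 : (⟨γ.im, γ.re⟩ : ZRing z) = star γ * ⟨0, 1⟩ := by ext <;> simp
  have hu : IsUnit (⟨0, 1⟩ : ZRing z) :=
    QuadraticAlgebra.isUnit_iff_norm_isUnit.2 (by rw [norm_eq]; simp)
  rw [h1, hu.dvd_mul_right, star_dvd_iff]

theorem swap_mem_positiveElements {M : ℤ} {γ : ZRing z} (h : γ ∈ positiveElements z M) :
    (⟨γ.im, γ.re⟩ : ZRing z) ∈ positiveElements z M := by
  obtain ⟨h1, h2, h3, h4⟩ := h
  refine ⟨h2, h1, h3.symm, ?_⟩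
  rw [norm_eq] at h4 ⊢
  linear_combination h4

theorem positivePrimitiveSolutions_eq_image (z M : ℤ) :
    positivePrimitiveSolutions z M =
      (fun γ : ZRing z => s(γ.re, γ.im)) '' positiveElements z M := by
  ext s
  constructor
  · rintro ⟨x, y, rfl, hx, hy, hM, hc⟩
    exact ⟨⟨x, y⟩, ⟨hx, hy, hc, by rw [norm_eq]; exact hM⟩, rfl⟩
  · rintro ⟨γ, ⟨h1, h2, h3, h4⟩, rfl⟩
    exact ⟨γ.re, γ.im, rfl, h1, h2, by rw [← norm_eq]; exact h4, h3⟩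

/-- A positive primitive element and its mirror image give the same solution, and the second is
divisible by the conjugates of the primes dividing the first. For `n > 0` the solutions therefore
correspond to the choices of one prime from each conjugate pair with `α 0` chosen, `2 ^ (n - 1)` in
number; for `n = 0` there is a single element, which is its own mirror image. -/
theorem ncard_positivePrimitiveSolutions [IsDomain (ZRing z)] (hz : 0 ≤ z) {n : ℕ}
    {g : ZRing z} {α : Fin n → ZRing z} {k : Fin n → ℕ} (hα : ∀ l, Prime (α l).norm)
    (hna : ∀ l, ¬ Associated (α l) (star (α l)))
    (hco : Pairwise fun i j => IsCoprime (α i).norm (α j).norm)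
    (hg : IsPrimitive g) (hgα : ∀ l, IsCoprime g.norm (α l).norm) (hk : ∀ l, k l ≠ 0)
    (hgd : ∀ γ : ZRing z, g.norm ∣ γ.norm → g ∣ γ)
    {M : ℤ} (hM : M = g.norm * ∏ l, (α l).norm ^ k l) (hM1 : 1 < M) :
    (positivePrimitiveSolutions z M).ncard = ⌈(2 : ℚ) ^ ((n : ℤ) - 1)⌉₊ := by
  have hinj := @eq_of_forall_dvd_iff z _ _ g α k _ hz hα hna hco hgα hk hgd M hM hM1
  have hsurj := @exists_forall_dvd_iff z _ _ g α k _ hα hna hco hg hgα hk M hM hM1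
  rw [positivePrimitiveSolutions_eq_image]
  cases n with
  | zero =>
    obtain ⟨γ, hγ, -⟩ := hsurj fun _ => True
    have : positiveElements z M = {γ} :=
      Set.eq_singleton_iff_unique_mem.2 ⟨hγ, fun δ hδ => hinj hδ hγ fun l => l.elim0⟩
    rw [this, Set.image_singleton, Set.ncard_singleton]
    symm
    rw [Nat.ceil_eq_iff one_ne_zero]
    norm_num
  | succ m =>
    -- exactly one of `γ` and its mirror image is divisible by `α 0`
    have himage : (fun γ : ZRing z => s(γ.re, γ.im)) '' positiveElements z M =
        (fun γ : ZRing z => s(γ.re, γ.im)) '' {γ ∈ positiveElements z M | α 0 ∣ γ} := by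
      refine Set.Subset.antisymm ?_ (Set.image_mono (Set.sep_subset _ _))
      rintro _ ⟨γ, hγ, rfl⟩
      have hd : (α 0).norm ∣ γ.norm := by
        rw [hγ.2.2.2, hM]
        exact ((dvd_pow_self _ (hk 0)).trans (Finset.dvd_prod_of_mem
          (fun l => (α l).norm ^ k l) (Finset.mem_univ 0))).mul_left _
      rcases dvd_or_star_dvd (hα 0) hd with h | h
      · exact ⟨γ, ⟨hγ, h⟩, rfl⟩
      · exact ⟨_, ⟨swap_mem_positiveElements hγ, dvd_swap_iff.2 h⟩, Sym2.eq_swap⟩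
    have hinjOn : Set.InjOn (fun γ : ZRing z => s(γ.re, γ.im))
        {γ ∈ positiveElements z M | α 0 ∣ γ} := by
      rintro γ ⟨hγ, hγ0⟩ δ ⟨hδ, hδ0⟩ h
      rcases Sym2.eq_iff.1 h with ⟨h1, h2⟩ | ⟨h1, h2⟩
      · exact QuadraticAlgebra.ext h1 h2
      · exfalso
        have : γ = ⟨δ.im, δ.re⟩ := QuadraticAlgebra.ext h1 h2
        rw [this, dvd_swap_iff] at hγ0
        exact hδ.2.2.1.not_star_dvd (hα 0) (hna 0) hδ0 hγ0
    have hbij : Set.BijOn (fun (γ : ZRing z) (l : Fin m) => α l.succ ∣ γ)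
        {γ ∈ positiveElements z M | α 0 ∣ γ} Set.univ := by
      refine ⟨Set.mapsTo_univ _ _, ?_, ?_⟩
      · rintro γ ⟨hγ, hγ0⟩ δ ⟨hδ, hδ0⟩ h
        refine hinj hγ hδ (Fin.cases (iff_of_true hγ0 hδ0) fun l => ?_)
        exact iff_of_eq (congrFun h l)
      · intro P _
        obtain ⟨γ, hγ, h⟩ := hsurj (Fin.cases True P)
        exact ⟨γ, ⟨hγ, (h 0).2 trivial⟩, funext fun l => propext (h l.succ)⟩
    have hcard : (Set.univ : Set (Fin m → Prop)).ncard = 2 ^ m := by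
      rw [Set.ncard_univ, Nat.card_eq_fintype_card]
      simp
    rw [himage, hinjOn.ncard_image, hbij.ncard_eq, hcard]
    have : (2 : ℚ) ^ (((m + 1 : ℕ) : ℤ) - 1) = ((2 ^ m : ℕ) : ℚ) := by
      push_cast
      rw [add_sub_cancel_right, zpow_natCast]
    rw [this, Nat.ceil_natCast]

end ZRing

/-! ### Counting the solutions -/

open ZRing

theorem mainTheorem1 (z : ℕ) :
    -- products of special elements and of non-special irregular primes `p j = α j * conj (α j)`
    (∀ (n : ℕ) (p : Fin n → ℤ) (α : Fin n → ZRing z) (k : Fin n → ℕ) (q₁ q₂ : ℤ) (r₁ r₂ M : ℕ),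
      (∀ j, ZRing.IsIrregularPrime z (p j)) →
      (∀ j, (p j : ZRing z) = α j * star (α j)) →
      (∀ j, ¬ ZRing.IsSpecialPrime z (p j)) →
      (∀ i j, i ≠ j → |p i| ≠ |p j|) →
      (∀ j, k j ≠ 0) →
      (ZRing.IsSpecialPrime z q₁ ∨ q₁ = 1) →
      (ZRing.IsSpecialPrime z q₂ ∨ q₂ = 1) →
      (ZRing.IsSpecialPrime z q₁ → ZRing.IsSpecialPrime z q₂ → |q₁| ≠ |q₂|) →
      (M : ℤ) = q₁ ^ r₁ * q₂ ^ r₂ * ∏ j, p j ^ k j →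
      1 < M →
        (r₁ ≤ 1 → r₂ ≤ 1 →
          (positivePrimitiveSolutions z M).ncard = ⌈(2 : ℚ) ^ ((n : ℤ) - 1)⌉₊) ∧
        ((q₁ ≠ 1 ∧ 2 ≤ r₁) ∨ (q₂ ≠ 1 ∧ 2 ≤ r₂) →
          ¬ ∃ x y : ℤ, IsPrimitiveSolution z M x y)) ∧
    -- unique factorization and divisibility by a regular prime
    (IsDomain (ZRing z) → UniqueFactorizationMonoid (ZRing z) →
      ∀ M : ℕ, 0 < M → (∃ p : ℤ, ZRing.IsRegularPrime z p ∧ p ∣ (M : ℤ)) →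
        ¬ ∃ x y : ℤ, IsPrimitiveSolution z M x y) := by

  refine ⟨?_, ?_⟩
  · intro n p α k q₁ q₂ r₁ r₂ M hirr hpα hns hne hk hq₁ hq₂ hq hM hM1
    have hM1' : (1 : ℤ) < M := by exact_mod_cast hM1
    have hnorm : ∀ l, (α l).norm = p l := fun l => norm_eq_of_intCast_eq_mul_star (hpα l)
    have hα : ∀ l, Prime (α l).norm := fun l => by rw [hnorm]; exact (hirr l).1
    have hna : ∀ l, ¬ Associated (α l) (star (α l)) := fun l h =>
      hns l ⟨hirr l, α l, hpα l, h⟩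
    have hspecial : ∀ q : ℤ, IsSpecialPrime z q → (z : ℤ) ≠ 2 := by
      rintro q ⟨⟨hp, -⟩, π, hπ, -⟩
      exact ne_two_of_prime_norm (α := π) (by rwa [norm_eq_of_intCast_eq_mul_star hπ])
    have hz : (0 : ℤ) ≤ z := Int.natCast_nonneg z
    -- for `z = 2` no prime is a norm, which leaves only the excluded empty product
    have hz2 : (z : ℤ) ≠ 2 := by
      intro h2
      have h1 : q₁ = 1 := hq₁.resolve_left fun h => hspecial _ h h2
      have h1' : q₂ = 1 := hq₂.resolve_left fun h => hspecial _ h h2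
      have hn : IsEmpty (Fin n) := ⟨fun l => ne_two_of_prime_norm (hα l) h2⟩
      rw [h1, h1'] at hM
      simp at hM
      omega
    have := isDomain hz hz2
    constructor
    · intro hr₁ hr₂
      obtain ⟨g₁, hn₁, hp₁, hd₁⟩ := exists_special_factor hq₁ hr₁
      obtain ⟨g₂, hn₂, hp₂, hd₂⟩ := exists_special_factor hq₂ hr₂
      have hqc : IsCoprime q₁ q₂ := by
        rcases hq₁ with h1 | rfl
        · rcases hq₂ with h2 | rfl
          · exact isCoprime_of_abs_ne h1.1.1 h2.1.1 (hq h1 h2)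
          · exact isCoprime_one_right
        · exact isCoprime_one_left
      have hgc : IsCoprime g₁.norm g₂.norm := by
        rw [hn₁, hn₂]; exact hqc.pow
      refine ncard_positivePrimitiveSolutions hz (g := g₁ * g₂) hα hna ?_ (hp₁.mul hp₂ hgc) ?_ hk
        ?_ ?_ hM1'
      · intro i j hij
        exact isCoprime_of_abs_ne (hα i) (hα j) (by rw [hnorm, hnorm]; exact hne i j hij)
      · intro l
        rw [map_mul, hn₁, hn₂]
        exact (isCoprime_special hq₁ (hα l) (hna l)).pow_left.mul_left
          (isCoprime_special hq₂ (hα l) (hna l)).pow_left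
      · intro γ hγ
        rw [map_mul] at hγ
        exact (isCoprime_of_isCoprime_norm hgc).mul_dvd
          (hd₁ γ (hn₁ ▸ (dvd_mul_right _ _).trans hγ)) (hd₂ γ (hn₂ ▸ (dvd_mul_left _ _).trans hγ))
      · simp only [map_mul, hn₁, hn₂, hnorm, hM]
    · rintro h ⟨x, y, hxy, hc⟩
      have key : ∀ q : ℤ, (IsSpecialPrime z q ∨ q = 1) → q ≠ 1 → ¬ q ^ 2 ∣ (M : ℤ) := by
        intro q hq hq1 hd
        obtain ⟨⟨hp, -⟩, π, hπ, ha⟩ := hq.resolve_right hq1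
        have hn := norm_eq_of_intCast_eq_mul_star hπ
        subst hn
        refine IsPrimitive.not_sq_dvd_norm (γ := ⟨x, y⟩) hc hp ha ?_
        have hM' : QuadraticAlgebra.norm (⟨x, y⟩ : ZRing z) = M := by rw [norm_eq]; exact hxy
        rwa [hM']
      rcases h with ⟨h1, h2⟩ | ⟨h1, h2⟩
      · refine key q₁ hq₁ h1 ((pow_dvd_pow q₁ h2).trans ?_)
        rw [hM, mul_assoc]
        exact dvd_mul_right _ _
      · refine key q₂ hq₂ h1 ((pow_dvd_pow q₂ h2).trans ?_)
        rw [hM]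
        exact (dvd_mul_left _ _).mul_right _
  · rintro _ _ M - ⟨p, ⟨hp, hreg⟩, hpM⟩ ⟨x, y, hxy, hc⟩
    -- an irreducible `p` is prime, so it divides `x + y i_z` or its conjugate
    have hnorm : QuadraticAlgebra.norm (⟨x, y⟩ : ZRing z) = M := by rw [norm_eq]; exact hxy
    have hd : (p : ZRing z) ∣ ⟨x, y⟩ * star ⟨x, y⟩ := by
      rw [← intCast_norm, hnorm]
      exact Int.cast_dvd_cast _ _ hpM
    have hprim : IsPrimitive (⟨x, y⟩ : ZRing z) := hc
    refine isPrimitive_iff.1 hprim p hp ?_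
    rcases hreg.prime.dvd_or_dvd hd with h | h
    · exact h
    · simpa using star_dvd_star h
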